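/- Conventions. A directed graph is a pair $G=(V,E)$ with $V$ a finite set and $E\subseteq V\times V$. A graph homomorphism $\varphi:G_1\to G_2$ (a map of vertices sending edges to edges) is a \emph{bidirectional cover} if it is surjective on edges and if $(u,v),(u,v')\in E_1$ implies $\varphi(v)=\varphi(v')$ and $(u,v),(u',v)\in E_1$ implies $\varphi(u)=\varphi(u')$. A circuit of length $l$ at $v_0$ is a closed walk $(v_0,v_1,\dots,v_l=v_0)$ with $v_0,\dots,v_{l-1}$ distinct; walks are added by concatenation. Construction. Fix integers $a_n\ge 2$ $(n\ge 0)$. Let $G_0$ have one vertex $v_{0,0}$ and one edge, the loop $e_{0,0}=(v_{0,0},v_{0,0})$. For $n\ge 1$, let $G_n$ be the graph consisting of a special vertex $v_{n,0}$ with a loop $e_{n,0}=(v_{n,0},v_{n,0})$ and of circuits $c_{n,1},\dots,c_{n,n}$ at $v_{n,0}$, any two of which have only the vertex $v_{n,0}$ in common. Define $\varphi_n:G_{n+1}\to G_n$ $(n\ge 0)$ by $\varphi_n(v_{n+1,0})=v_{n,0}$, by mapping all vertices of $c_{n+1,n+1}$ to $v_{n,0}$, and, for $1\le i\le n$, by mapping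 $c_{n+1,i}$, vertex by vertex, onto the walk $$\varphi_n(c_{n+1,i}) = e_{n,0}+2c_{n,i}+2c_{n,i+1}+\dots+2c_{n,n}+e_{n,0}.$$ Thus $c_{n+1,n+1}$ has the arbitrary length $a_n$, and for $1\le i\le n$ the length of $c_{n+1,i}$ is $2+2\sum_{k=i}^n l(c_{n,k})$. Let $$X=\Big\{(x_n)_{n\ge 0}\in\prod_{n\ge 0} V(G_n) : x_n=\varphi_n(x_{n+1})\text{ for all }n\Big\}$$ with the topology induced by the product of the discrete topologies. Theorem. For every choice of the lengths $a_n\ge 2$, the maps $\varphi_n$ are bidirectional covers, and the relation $\{(x,y)\in X\times X : (x_n,y_n)\in E(G_n)\text{ for all }n\}$ is the graph of a homeomorphism $f:X\to X$. The space $X$ is homeomorphic to the Cantor set, and: 1. $(X,f)$ is completely scrambled: for every metric $d$ on $X$ inducing its topology and all $x\ne y$ in $X$, $$\limsup_{k\to+\infty}d(f^k(x),f^k(y))>0\quad\text{and}\quad\liminf_{k\to+\infty}d(f^k(x),f^k(y))=0.$$ 2. $(X,f)$ is topologically transitive: for all nonempty open $U,V\subseteq X$ there is $k\ge 0$ with $f^k(U)\cap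 V\neq\emptyset$. 3. $(X,f)$ is not locally equicontinuous: it is not true that every $x\in X$ is an equicontinuity point, for the family $(f^k)_{k\ge 0}$ and a compatible metric, of the restriction of $f$ to the closure of the orbit $\{f^k(x):k\in\mathbb Z\}$. -/

import Mathlib

/-! ### Notions of topological dynamics -/

namespace TopDyn

/-- `S` is a scrambled set for `f`: any two distinct points `x, y` of `S` satisfy
`limsup d(fⁿ x, fⁿ y) > 0` and `liminf d(fⁿ x, fⁿ y) = 0` as `n → ∞`.
(The metric is read in `[0, ∞]`, so that both limits always make sense.) -/
def IsScrambledSet {X : Type*} [MetricSpace X] (f : X → X) (S : Set X) : Prop :=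
  ∀ x ∈ S, ∀ y ∈ S, x ≠ y →
    0 < Filter.limsup (fun n : ℕ => edist (f^[n] x) (f^[n] y)) Filter.atTop ∧
    Filter.liminf (fun n : ℕ => edist (f^[n] x) (f^[n] y)) Filter.atTop = 0

/-- `f` is completely scrambled: the whole space is a scrambled set. -/
def CompletelyScrambled {X : Type*} [MetricSpace X] (f : X → X) : Prop :=
  IsScrambledSet f Set.univ

/-- The (full) orbit of `x` under an invertible map. -/
def orbit {X : Type*} (f : Equiv.Perm X) (x : X) : Set X :=
  Set.range fun n : ℤ => (f ^ n) x

/-- Local equicontinuity: every point `x` is an equicontinuity point, for the forward iterates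
of `f`, of the system restricted to the closure of the orbit of `x`. -/
def LocallyEquicontinuous {X : Type*} [MetricSpace X] (f : Equiv.Perm X) : Prop :=
  ∀ x : X, EquicontinuousWithinAt (fun n : ℕ => (⇑f)^[n]) (closure (orbit f x)) x

/-- Topological transitivity: for all nonempty open sets `U`, `V`, some forward image of `U`
meets `V`. -/
def TopologicallyTransitive {X : Type*} [TopologicalSpace X] (f : X → X) : Prop :=
  ∀ U V : Set X, IsOpen U → IsOpen V → U.Nonempty → V.Nonempty →
    ∃ n : ℕ, (f^[n] '' U ∩ V).Nonempty

end TopDyn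

/-! ### Graph covers -/

namespace GraphCover

/-- `φ : G₁ → G₂` is a bidirectional cover: an edge-surjective graph homomorphism which identifies
any two out-neighbours of a vertex and any two in-neighbours of a vertex. -/
structure IsBidirectionalCover {V₁ V₂ : Type*} (G₁ : Digraph V₁) (G₂ : Digraph V₂)
    (φ : V₁ → V₂) : Prop where
  hom : ∀ u v, G₁.Adj u v → G₂.Adj (φ u) (φ v)
  edge_surjective : ∀ u' v', G₂.Adj u' v' → ∃ u v, G₁.Adj u v ∧ φ u = u' ∧ φ v = v'
  plus_directional : ∀ u v v', G₁.Adj u v → G₁.Adj u v' → φ v = φ v'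
  minus_directional : ∀ u u' v, G₁.Adj u v → G₁.Adj u' v → φ u = φ u'

end GraphCover

/-! ### The sequence of generalized figure-8 graphs

Throughout, `a : ℕ → ℕ` prescribes the free lengths: the new circuit `c_{n+1,n+1}` of `G_{n+1}`
has length `a n`. -/

namespace FigureEight

/-- The length `l(n,i)` of the circuit `c_{n,i}`, for `1 ≤ i ≤ n` (irrelevant for other `i`). -/
def len (a : ℕ → ℕ) : ℕ → ℕ → ℕ
  | 0, _ => 0
  | n + 1, i => if i ≤ n then 1 + (∑ k ∈ Finset.Icc i n, 2 * len a n k) + 1 else a n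

/-- The vertices of `G_n`: the special vertex `v_{n,0}` (`base`), and the vertices `v_{n,i,j}`
with `1 ≤ i ≤ n` and `0 < j < l(n,i)` (`inner i j`). -/
inductive Vertex (a : ℕ → ℕ) (n : ℕ) : Type
  | base : Vertex a n
  | inner (i j : ℕ) (hi : 1 ≤ i ∧ i ≤ n) (hj : 0 < j ∧ j < len a n i) : Vertex a n

/-- `circ a n i j` is the `j`-th vertex `v_{n,i,j}` of the circuit `c_{n,i}`, `0 ≤ j ≤ l(n,i)`;
it is the special vertex for `j = 0` and for `j = l(n,i)`. -/
def circ (a : ℕ → ℕ) (n i j : ℕ) : Vertex a n :=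
  if h : (1 ≤ i ∧ i ≤ n) ∧ (0 < j ∧ j < len a n i) then .inner i j h.1 h.2 else .base

/-- The graph `G_n`: its edges are the special edge `e` (a loop at the special vertex) and the
edges of the circuits `c_{n,1}, …, c_{n,n}`. -/
def graph (a : ℕ → ℕ) (n : ℕ) : Digraph (Vertex a n) where
  Adj u v := (u = .base ∧ v = .base) ∨
    ∃ i j, 1 ≤ i ∧ i ≤ n ∧ j < len a n i ∧ u = circ a n i j ∧ v = circ a n i (j + 1)

/-- The circuit `c_{n,i}` as a closed walk. Closed walks at the special vertex are recorded by the
list of their vertices without the last one, which is the special vertex again; the sum of two such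
walks is then the concatenation of the lists, and the length of the walk is that of the list. -/
def circWalk (a : ℕ → ℕ) (n i : ℕ) : List (Vertex a n) :=
  (List.range (len a n i)).map (circ a n i)

/-- The closed walk `e + 2 c_{n,i} + 2 c_{n,i+1} + ⋯ + 2 c_{n,n} + e` of `G_n`
(`List.range' i (n + 1 - i)` is the list `[i, i + 1, …, n]`). -/
def imageWalk (a : ℕ → ℕ) (n i : ℕ) : List (Vertex a n) :=
  [.base] ++ (List.range' i (n + 1 - i)).flatMap (fun k => circWalk a n k ++ circWalk a n k)
    ++ [.base]

/-- The map `φ_n : G_{n+1} → G_n`. It sends the special vertex to the special vertex, the circuit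
`c_{n+1,n+1}` to the special vertex, and, for `1 ≤ i ≤ n`, the circuit `c_{n+1,i}` onto the walk
`e + 2 c_{n,i} + ⋯ + 2 c_{n,n} + e`, vertex by vertex. -/
def cover (a : ℕ → ℕ) (n : ℕ) : Vertex a (n + 1) → Vertex a n
  | .base => .base
  | .inner i j _ _ => if i ≤ n then (imageWalk a n i).getD j .base else .base

/-- The inverse limit `X` of `G_0 ← G_1 ← G_2 ← ⋯`. -/
def Limit (a : ℕ → ℕ) : Type :=
  {x : ∀ n, Vertex a n // ∀ n, x n = cover a n (x (n + 1))}

/-- Each finite vertex set carries the discrete topology. -/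
instance instTopologicalSpaceVertex (a : ℕ → ℕ) (n : ℕ) : TopologicalSpace (Vertex a n) := ⊥

/-- The inverse limit carries the topology induced by the product topology. -/
instance instTopologicalSpaceLimit (a : ℕ → ℕ) : TopologicalSpace (Limit a) :=
  inferInstanceAs
    (TopologicalSpace {x : ∀ n, Vertex a n // ∀ n, x n = cover a n (x (n + 1))})

/-- The edge relation of the inverse limit: `(x_n, y_n)` is an edge of `G_n` for every `n`. -/
def limitEdge (a : ℕ → ℕ) (x y : Limit a) : Prop :=
  ∀ n, (graph a n).Adj (x.1 n) (y.1 n)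

end FigureEight

/-! Each walk `imageWalk` begins and ends with the loop `e`, so every neighbour of the special
vertex of `G_{n+1}` is sent to the special vertex of `G_n`; all other vertices have a unique
successor and predecessor. Hence the covers are bidirectional, and the next point is read off from
one level higher (`shift`, `unshift`). Every vertex has two preimages, so the compact limit has no
isolated points and is a Cantor set. Transitivity holds because `c_{n+1,1}` meets every vertex of
`G_n` and is itself run through twice by `c_{n+2,1}`.

Proximality: a point at the special vertex of level `n + r` stays at that of level `n` for `r` steps
(`iterate_coord_eq_base`), while every point visits the latter within a bounded time. A large `r`
forces a common visit.

No distinct asymptotic pairs: if `x` and `y` eventually agree at level `n`, then by induction on `m`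
they complete the circuits `c_{m,j}`, `j ≤ n`, at the same late times (`IsLast.of_eventually_eq`). A
point other than the fixed one lies, at all high levels, on circuits of one index `i`. For `n > i`,
its time to completion outgrows the delay `trail` of the induction
(`HasLimitIndex.remaining_trail`), so both points have the same remaining time at all high levels.
The growth of this time determines the index, and the index and the remaining time determine the
position; thus `x = y` (`eq_of_asymptotic`).

Equicontinuity fails at `diagonal`: its orbit returns arbitrarily close, to the second copy of
`c_{m,1}` in `c_{m+1,1}`. Later one point begins that second copy while the other begins `c_{m,2}`,
which level 2 distinguishes. -/

namespace FigureEight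

variable {a : ℕ → ℕ}

/-! ### Positions on the circuits -/

/-- The position on `c_{n+1,i}` at which the first of the two copies of `c_{n,k}` begins. -/
def off (a : ℕ → ℕ) (n i k : ℕ) : ℕ := 1 + ∑ k' ∈ Finset.Ico i k, 2 * len a n k'

@[simp] lemma off_self (n i : ℕ) : off a n i i = 1 := by simp [off]

lemma off_succ {n i k : ℕ} (h : i ≤ k) : off a n i (k + 1) = off a n i k + 2 * len a n k := by
  simp [off, Finset.sum_Ico_succ_top h, add_assoc]

lemma off_mono (n i : ℕ) {k k' : ℕ} (h : k ≤ k') : off a n i k ≤ off a n i k' := by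
  unfold off
  gcongr

lemma one_le_off (n i k : ℕ) : 1 ≤ off a n i k := by simp [off]

lemma len_succ {n i : ℕ} (h : i ≤ n) : len a (n + 1) i = off a n i (n + 1) + 1 := by
  simp only [len, h, if_true, off]
  rfl

lemma off_add_le {n i k : ℕ} (hi : i ≤ k) (hk : k ≤ n) :
    off a n i k + 2 * len a n k + 1 ≤ len a (n + 1) i := by
  rw [len_succ (hi.trans hk), ← off_succ hi]
  exact Nat.succ_le_succ (off_mono n i (Nat.succ_le_succ hk))

lemma two_le_len (ha : ∀ n, 2 ≤ a n) {n i : ℕ} (hi : 1 ≤ i) (hn : i ≤ n) : 2 ≤ len a n i := by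
  obtain ⟨n, rfl⟩ : ∃ m, n = m + 1 := ⟨n - 1, by omega⟩
  by_cases h : i ≤ n
  · rw [len_succ h]
    have := one_le_off (a := a) n i (n + 1)
    omega
  · simpa [len, h] using ha n

/-- Every position on `c_{n+1,i}` is an endpoint or lies on a copy of some `c_{n,k}`. -/
lemma exists_position {n i j : ℕ} (hi : i ≤ n) (hj : j < len a (n + 1) i) :
    j = 0 ∨ j + 1 = len a (n + 1) i ∨ ∃ k ε d, i ≤ k ∧ k ≤ n ∧ ε ≤ 1 ∧ d < len a n k ∧
      j = off a n i k + ε * len a n k + d := by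
  rcases Nat.eq_zero_or_pos j with h0 | h0
  · exact Or.inl h0
  rw [len_succ hi] at hj ⊢
  rcases Nat.lt_or_ge j (off a n i (n + 1)) with h | h
  · right; right
    have key : ∀ m, i ≤ m → m ≤ n + 1 → j < off a n i m → ∃ k, i ≤ k ∧ k < m ∧
        off a n i k ≤ j ∧ j < off a n i (k + 1) := by
      intro m hm
      induction m, hm using Nat.le_induction with
      | base => intro _ h; simp at h; omega
      | succ m hm ih =>
        intro hmn h
        by_cases hlt : j < off a n i m
        · obtain ⟨k, h1, h2, h3⟩ := ih (by omega) hlt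
          exact ⟨k, h1, by omega, h3⟩
        · exact ⟨m, hm, by omega, by omega, h⟩
    obtain ⟨k, h1, h2, h3, h4⟩ := key (n + 1) (by omega) le_rfl h
    rw [off_succ h1] at h4
    by_cases hlt : j < off a n i k + len a n k
    · exact ⟨k, 0, j - off a n i k, h1, by omega, by omega, by omega, by omega⟩
    · exact ⟨k, 1, j - off a n i k - len a n k, h1, by omega, by omega, by omega, by omega⟩
  · exact Or.inr (Or.inl (by omega))

lemma circ_of_lt {n i j : ℕ} (hi : 1 ≤ i ∧ i ≤ n) (hj : 0 < j ∧ j < len a n i) :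
    circ a n i j = .inner i j hi hj := dif_pos ⟨hi, hj⟩

@[simp] lemma circ_zero (n i : ℕ) : circ a n i 0 = .base := by simp [circ]

lemma circ_of_len_le {n i j : ℕ} (h : len a n i ≤ j) : circ a n i j = .base := by
  simp [circ, Nat.not_lt.mpr h]

@[simp] lemma circ_len (n i : ℕ) : circ a n i (len a n i) = .base := circ_of_len_le le_rfl

lemma circ_ne_base {n i j : ℕ} (hi : 1 ≤ i ∧ i ≤ n) (hj : 0 < j ∧ j < len a n i) :
    circ a n i j ≠ .base := by
  simp [circ_of_lt hi hj]

lemma circ_inj {n i j i' j' : ℕ} (h : circ a n i j = circ a n i' j') (h0 : circ a n i j ≠ .base) :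
    i = i' ∧ j = j' := by
  have h0' := h ▸ h0
  unfold circ at h h0 h0'
  split_ifs at h h0 h0' with h1 h2
  all_goals simp_all

lemma of_circ_ne_base {n i j : ℕ} (h : circ a n i j ≠ .base) :
    (1 ≤ i ∧ i ≤ n) ∧ (0 < j ∧ j < len a n i) := by
  by_contra h'
  exact h (dif_neg h')

lemma exists_eq_circ {n : ℕ} (v : Vertex a n) (h : v ≠ .base) :
    ∃ i j, (1 ≤ i ∧ i ≤ n) ∧ (0 < j ∧ j < len a n i) ∧ v = circ a n i j := by
  cases v with
  | base => exact absurd rfl h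
  | inner i j hi hj => exact ⟨i, j, hi, hj, (circ_of_lt hi hj).symm⟩

/-! ### The covering maps -/

lemma length_circWalk (n i : ℕ) : (circWalk a n i).length = len a n i := by simp [circWalk]

lemma getD_circWalk (n i j : ℕ) : (circWalk a n i).getD j .base = circ a n i j := by
  by_cases h : j < len a n i
  · simp [circWalk, List.getD_eq_getElem?_getD, h]
  · rw [List.getD_eq_default _ _ (by rw [length_circWalk]; omega), circ_of_len_le (by omega)]

lemma length_flatMap_circWalk (n i c : ℕ) :
    ((List.range' i c).flatMap (fun k => circWalk a n k ++ circWalk a n k)).length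
      = ∑ k ∈ Finset.Ico i (i + c), 2 * len a n k := by
  induction c with
  | zero => simp
  | succ c ih =>
    rw [← add_assoc, Finset.sum_Ico_succ_top (by omega), ← ih, List.range'_concat]
    simp [length_circWalk, two_mul]

lemma length_imageWalk {n i : ℕ} (h : i ≤ n) : (imageWalk a n i).length = len a (n + 1) i := by
  rw [len_succ h, imageWalk, List.length_append, List.length_append, length_flatMap_circWalk,
    show i + (n + 1 - i) = n + 1 by omega]
  simp [off]

/-- Cutting the index range at `k` leaves a prefix of length `off a n i k`, followed by the two
copies of `c_{n,k}`. -/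
lemma getD_imageWalk {n i k ε d : ℕ} (hi : i ≤ k) (hk : k ≤ n) (hε : ε ≤ 1) (hd : d < len a n k) :
    (imageWalk a n i).getD (off a n i k + ε * len a n k + d) .base = circ a n k d := by
  have h : List.range' i (n + 1 - i) =
      List.range' i (k - i) ++ (k :: List.range' (k + 1) (n - k)) := by
    have h1 : n + 1 - i = (k - i) + ((n - k) + 1) := by omega
    rw [h1, ← List.range'_append_1, List.range'_succ, show i + (k - i) = k by omega]
  have hlen := length_flatMap_circWalk (a := a) n i (k - i)
  rw [show i + (k - i) = k by omega] at hlen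
  rw [imageWalk, h, List.flatMap_append, List.flatMap_cons]
  set P := (List.range' i (k - i)).flatMap (fun k => circWalk a n k ++ circWalk a n k) with hP
  have hl := length_circWalk (a := a) n k
  have hpre : ([Vertex.base] ++ P).length = off a n i k := by
    rw [List.length_append, hlen, off, List.length_singleton]
  rw [← List.append_assoc, List.append_assoc, List.append_assoc (circWalk a n k ++ _),
    List.append_assoc (circWalk a n k), add_assoc,
    List.getD_append_right _ _ _ _ (by omega), hpre, Nat.add_sub_cancel_left]
  interval_cases ε
  · rw [zero_mul, zero_add, List.getD_append _ _ _ _ (by omega), getD_circWalk]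
  · rw [one_mul, List.getD_append_right _ _ _ _ (by omega), hl, Nat.add_sub_cancel_left,
      List.getD_append _ _ _ _ (by omega), getD_circWalk]

@[simp] lemma cover_base (n : ℕ) : cover a n .base = .base := rfl

lemma cover_circ {n i : ℕ} (h1 : 1 ≤ i) (hi : i ≤ n) (j : ℕ) :
    cover a n (circ a (n + 1) i j) = (imageWalk a n i).getD j .base := by
  by_cases hj : 0 < j ∧ j < len a (n + 1) i
  · rw [circ_of_lt ⟨h1, by omega⟩ hj]
    simp [cover, hi]
  · rcases Nat.eq_zero_or_pos j with rfl | h0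
    · simp [imageWalk]
    · have : len a (n + 1) i ≤ j := by omega
      rw [circ_of_len_le this, List.getD_eq_default _ _ (by rwa [length_imageWalk hi])]
      rfl

lemma cover_circ_of_gt {n i : ℕ} (hi : n < i) (j : ℕ) :
    cover a n (circ a (n + 1) i j) = .base := by
  unfold circ
  split_ifs with h
  · simp [cover, Nat.not_le.mpr hi]
  · rfl

/-- This is the final `e` of the image walk; positions past the end are also allowed, where `circ`
takes its default value. -/
lemma cover_circ_last {n i j : ℕ} (h1 : 1 ≤ i) (hj : len a (n + 1) i ≤ j + 1) :
    cover a n (circ a (n + 1) i j) = .base := by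
  rcases Nat.lt_or_ge n i with hi | hi
  · exact cover_circ_of_gt hi j
  rw [cover_circ h1 hi, imageWalk]
  have hl : ([Vertex.base] ++ (List.range' i (n + 1 - i)).flatMap
      (fun k => circWalk a n k ++ circWalk a n k)).length + 1 = len a (n + 1) i := by
    rw [← length_imageWalk hi]; simp [imageWalk]
  rw [List.getD_append_right _ _ _ _ (by omega)]
  cases j - _ <;> simp

/-- The covering map on the copy number `ε` of `c_{n,k}` in `c_{n+1,i}`. -/
lemma cover_circ_off {n i k ε d : ℕ} (h1 : 1 ≤ i) (hi : i ≤ k) (hk : k ≤ n) (hε : ε ≤ 1)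
    (hd : d ≤ len a n k) :
    cover a n (circ a (n + 1) i (off a n i k + ε * len a n k + d)) = circ a n k d := by
  rcases hd.lt_or_eq with hd | rfl
  · rw [cover_circ h1 (hi.trans hk), getD_imageWalk hi hk hε hd]
  -- The end of a copy is either the final `e` or the start of another copy; the latter amounts to
  -- `d' = 0` below.
  · rw [circ_len]
    have hlast := off_add_le (a := a) hi hk
    rcases Nat.lt_or_ge (off a n i k + ε * len a n k + len a n k + 1) (len a (n + 1) i) with h | h
    swap
    · exact cover_circ_last h1 h
    rcases exists_position (hi.trans hk) (Nat.lt_of_succ_lt h) with h' | h' | h'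
    · have := one_le_off (a := a) n i k
      omega
    · omega
    obtain ⟨k', ε', d', hi', hk', hε', hd', he⟩ := h'
    rw [he, cover_circ h1 (hi.trans hk), getD_imageWalk hi' hk' hε' hd']
    suffices d' = 0 by subst this; simp
    rcases lt_trichotomy k k' with hkk | rfl | hkk
    · have h2 := off_mono (a := a) n i (Nat.succ_le_of_lt hkk)
      rw [Nat.succ_eq_add_one, off_succ hi] at h2
      have h3 : ε * len a n k ≤ 1 * len a n k := Nat.mul_le_mul_right _ hε
      have : off a n i k' ≤ off a n i k + ε * len a n k + len a n k := by
        rw [he]; omega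
      have h4 : off a n i k' = off a n i k + 2 * len a n k := by omega
      omega
    · interval_cases ε <;> interval_cases ε' <;> omega
    · have h2 := off_mono (a := a) n i (Nat.succ_le_of_lt hkk)
      rw [Nat.succ_eq_add_one, off_succ hi'] at h2
      have h3 : ε' * len a n k' ≤ 1 * len a n k' := Nat.mul_le_mul_right _ hε'
      omega

lemma cover_circ_one {n i : ℕ} (h1 : 1 ≤ i) : cover a n (circ a (n + 1) i 1) = .base := by
  rcases Nat.lt_or_ge n i with hi | hi
  · exact cover_circ_of_gt hi 1
  · simpa using cover_circ_off (a := a) (ε := 0) (d := 0) h1 le_rfl hi (by omega) (by omega)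

/-- A vertex of `c_{n+1,q}` over a vertex of `c_{n,k}` lies on one of its two copies. -/
lemma position_of_cover_eq {n q p k d : ℕ} (hq : 1 ≤ q)
    (h : cover a n (circ a (n + 1) q p) = circ a n k d) (h0 : circ a n k d ≠ .base) :
    q ≤ k ∧ ∃ ε ≤ 1, p = off a n q k + ε * len a n k + d := by
  rcases Nat.lt_or_ge n q with hqn | hqn
  · exact absurd (h ▸ cover_circ_of_gt hqn p) h0
  rcases Nat.lt_or_ge p (len a (n + 1) q) with hp | hp
  swap
  · exact absurd (h ▸ cover_circ_last hq (by omega)) h0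
  rcases exists_position hqn hp with rfl | h' | ⟨k', ε, d', h1, h2, h3, h4, h5⟩
  · simp at h; exact absurd h.symm h0
  · exact absurd (h ▸ cover_circ_last hq h'.ge) h0
  · rw [h5, cover_circ_off hq h1 h2 h3 h4.le] at h
    obtain ⟨rfl, rfl⟩ := circ_inj h (h ▸ h0)
    exact ⟨h1, ε, h3, h5⟩

/-! ### Successors and predecessors -/

/-- An out-neighbour of each vertex. -/
def next {n : ℕ} : Vertex a n → Vertex a n
  | .base => .base
  | .inner i j _ _ => circ a n i (j + 1)

/-- An in-neighbour of each vertex. -/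
def prev {n : ℕ} : Vertex a n → Vertex a n
  | .base => .base
  | .inner i j _ _ => circ a n i (j - 1)

lemma adj_circ {n i j : ℕ} (hi : 1 ≤ i ∧ i ≤ n) (hj : j < len a n i) :
    (graph a n).Adj (circ a n i j) (circ a n i (j + 1)) :=
  Or.inr ⟨i, j, hi.1, hi.2, hj, rfl, rfl⟩

lemma adj_base (n : ℕ) : (graph a n).Adj .base .base := Or.inl ⟨rfl, rfl⟩

lemma adj_next {n : ℕ} (v : Vertex a n) : (graph a n).Adj v (next v) := by
  cases v with
  | base => exact adj_base n
  | inner i j hi hj =>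
    rw [next, ← circ_of_lt hi hj]
    exact adj_circ hi hj.2

lemma adj_prev {n : ℕ} (v : Vertex a n) : (graph a n).Adj (prev v) v := by
  cases v with
  | base => exact adj_base n
  | inner i j hi hj =>
    have := adj_circ (a := a) (j := j - 1) hi (by omega)
    rwa [Nat.sub_add_cancel hj.1, circ_of_lt hi hj] at this

/-- Only the special vertex has several out-neighbours, and the initial `e` of each image walk sends
all of them to the special vertex. -/
lemma cover_eq_of_adj {n : ℕ} {u v : Vertex a (n + 1)} (h : (graph a (n + 1)).Adj u v) :
    cover a n v = cover a n (next u) := by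
  rcases h with ⟨rfl, rfl⟩ | ⟨i, j, h1, h2, hj, rfl, rfl⟩
  · rfl
  · rcases Nat.eq_zero_or_pos j with rfl | h0
    · rw [circ_zero]; exact cover_circ_one h1
    · rw [circ_of_lt ⟨h1, h2⟩ ⟨h0, hj⟩, next]

lemma cover_eq_of_adj' {n : ℕ} {u v : Vertex a (n + 1)} (h : (graph a (n + 1)).Adj u v) :
    cover a n u = cover a n (prev v) := by
  rcases h with ⟨rfl, rfl⟩ | ⟨i, j, h1, h2, hj, rfl, rfl⟩
  · rfl
  · rcases Nat.lt_or_ge (j + 1) (len a (n + 1) i) with h | h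
    · rw [circ_of_lt ⟨h1, h2⟩ ⟨by omega, h⟩, prev, Nat.add_sub_cancel]
    · rw [circ_of_len_le h]; exact cover_circ_last h1 h

lemma adj_cover {n : ℕ} {u v : Vertex a (n + 1)} (h : (graph a (n + 1)).Adj u v) :
    (graph a n).Adj (cover a n u) (cover a n v) := by
  rcases h with ⟨rfl, rfl⟩ | ⟨i, j, h1, h2, hj, rfl, rfl⟩
  · exact adj_base n
  rcases Nat.lt_or_ge n i with hi | hi
  · simpa only [cover_circ_of_gt hi] using adj_base n
  rcases exists_position hi hj with rfl | h' | ⟨k, ε, d, h3, h4, h5, h6, rfl⟩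
  · simpa only [circ_zero, cover_base, zero_add, cover_circ_one h1] using adj_base n
  · rw [cover_circ_last h1 h'.ge, cover_circ_last h1 (by omega)]; exact adj_base n
  · rw [add_assoc _ d 1, cover_circ_off h1 h3 h4 h5 h6.le, cover_circ_off h1 h3 h4 h5 h6]
    exact adj_circ ⟨by omega, h4⟩ h6

theorem isBidirectionalCover_cover (a : ℕ → ℕ) (n : ℕ) :
    GraphCover.IsBidirectionalCover (graph a (n + 1)) (graph a n) (cover a n) where
  hom _ _ := adj_cover
  edge_surjective := by
    rintro u v (⟨rfl, rfl⟩ | ⟨i, j, h1, h2, hj, rfl, rfl⟩)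
    · exact ⟨.base, .base, adj_base _, rfl, rfl⟩
    · have := off_add_le (a := a) h1 h2
      refine ⟨_, _, adj_circ (i := 1) (j := off a n 1 i + 0 * len a n i + j)
        ⟨le_rfl, by omega⟩ (by omega), cover_circ_off le_rfl h1 h2 (by omega) hj.le, ?_⟩
      rw [add_assoc _ j 1, cover_circ_off le_rfl h1 h2 (by omega) hj]
  plus_directional _ _ _ h h' := (cover_eq_of_adj h).trans (cover_eq_of_adj h').symm
  minus_directional _ _ _ h h' := (cover_eq_of_adj' h).trans (cover_eq_of_adj' h').symm

lemma adj_circ_iff {n i j : ℕ} (h0 : circ a n i j ≠ .base) (v : Vertex a n) :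
    (graph a n).Adj (circ a n i j) v ↔ v = circ a n i (j + 1) := by
  constructor
  · rintro (⟨h, -⟩ | ⟨i', j', h1, h2, hj, h, rfl⟩)
    · exact absurd h h0
    · obtain ⟨rfl, rfl⟩ := circ_inj h h0
      rfl
  · rintro rfl
    have h := of_circ_ne_base h0
    exact adj_circ h.1 h.2.2

lemma eq_of_adj_circ_succ {n i j : ℕ} (h0 : circ a n i (j + 1) ≠ .base) {u : Vertex a n}
    (h : (graph a n).Adj u (circ a n i (j + 1))) : u = circ a n i j := by
  rcases h with ⟨-, h⟩ | ⟨i', j', h1, h2, hj, rfl, h⟩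
  · exact absurd h h0
  · obtain ⟨rfl, h'⟩ := circ_inj h h0
    rw [Nat.succ.inj h']

/-- The circuit `c_{n+1,1}` runs through all the vertices of `G_n`. -/
lemma exists_cover_circ_one (ha : ∀ n, 2 ≤ a n) {n : ℕ} (v : Vertex a n) :
    ∃ p, 0 < p ∧ p < len a (n + 1) 1 ∧ cover a n (circ a (n + 1) 1 p) = v := by
  cases v with
  | base => exact ⟨1, one_pos, two_le_len ha le_rfl (by omega), cover_circ_one le_rfl⟩
  | inner i j hi hj =>
    have := off_add_le (a := a) hi.1 hi.2
    refine ⟨off a n 1 i + 0 * len a n i + j, by omega, by omega, ?_⟩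
    rw [cover_circ_off le_rfl hi.1 hi.2 (by omega) hj.2.le, circ_of_lt hi hj]

/-- The two copies of each circuit inside `c_{n+1,1}` supply the two preimages; this excludes
isolated points of the limit. -/
lemma exists_two_cover_eq (ha : ∀ n, 2 ≤ a n) {n : ℕ} (v : Vertex a n) :
    ∃ u u', u ≠ u' ∧ cover a n u = v ∧ cover a n u' = v := by
  cases v with
  | base =>
    exact ⟨_, _, circ_ne_base (i := 1) ⟨le_rfl, by omega⟩
      ⟨one_pos, two_le_len ha le_rfl (by omega)⟩, cover_circ_one le_rfl, cover_base n⟩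
  | inner i j hi hj =>
    have := off_add_le (a := a) hi.1 hi.2
    refine ⟨_, _, fun h => ?_,
      (cover_circ_off (ε := 0) le_rfl hi.1 hi.2 (by omega) hj.2.le).trans (circ_of_lt hi hj),
      (cover_circ_off (ε := 1) le_rfl hi.1 hi.2 (by omega) hj.2.le).trans (circ_of_lt hi hj)⟩
    have := (circ_inj h (circ_ne_base ⟨le_rfl, by omega⟩ ⟨by omega, by omega⟩)).2
    omega

end FigureEight

/-! ### Brouwer's characterization of the Cantor space -/

namespace CantorScheme

open Set

variable {X : Type*}

/-- The branch `s` of the binary tree of sets in which the node `A` of level `n` has the children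
`sp A n` and `A \ sp A n`. -/
def branch (sp : Set X → ℕ → Set X) (s : ℕ → Bool) : ℕ → Set X
  | 0 => univ
  | n + 1 => if s n then sp (branch sp s n) n else branch sp s n \ sp (branch sp s n) n

open Classical in
/-- The node of level `n` which contains `x`. -/
noncomputable def node (sp : Set X → ℕ → Set X) (x : X) : ℕ → Set X
  | 0 => univ
  | n + 1 => if x ∈ sp (node sp x n) n then sp (node sp x n) n else node sp x n \ sp (node sp x n) n

open Classical in
/-- The address of `x`. -/
noncomputable def code (sp : Set X → ℕ → Set X) (x : X) (n : ℕ) : Bool :=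
  decide (x ∈ sp (node sp x n) n)

variable {sp : Set X → ℕ → Set X}

lemma branch_code (x : X) (n : ℕ) : branch sp (code sp x) n = node sp x n := by
  induction n with
  | zero => rfl
  | succ n ih =>
    rw [branch, node, ih, code]
    by_cases h : x ∈ sp (node sp x n) n <;> simp [h]

lemma branch_congr {s t : ℕ → Bool} {n : ℕ} (h : ∀ k < n, s k = t k) :
    branch sp s n = branch sp t n := by
  induction n with
  | zero => rfl
  | succ n ih => rw [branch, branch, ih fun k hk => h k (by omega), h n (by omega)]

lemma mem_branch_iff (hsp : ∀ A n, sp A n ⊆ A) {s : ℕ → Bool} {x : X} {n : ℕ} :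
    x ∈ branch sp s n ↔ ∀ k < n, code sp x k = s k := by
  induction n with
  | zero => simp [branch]
  | succ n ih =>
    have key : (∀ k < n, code sp x k = s k) →
        (x ∈ branch sp s (n + 1) ↔ code sp x n = s n) := by
      intro h
      have hx := ih.mpr h
      have e : node sp x n = branch sp s n := (branch_code x n).symm.trans (branch_congr h)
      rw [branch, code, e]
      cases s n <;> simp [hx]
    constructor
    · intro hx
      have h : x ∈ branch sp s n := by
        rw [branch] at hx
        split_ifs at hx
        · exact hsp _ _ hx
        · exact hx.1
      intro k hk
      rcases Nat.lt_succ_iff_lt_or_eq.mp hk with hk | rfl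
      · exact ih.mp h k hk
      · exact (key (ih.mp h)).mp hx
    · intro h
      exact (key fun k hk => h k (by omega)).mpr (h n (by omega))

/-- A nonempty compact space without isolated points whose points are separated by countably many
clopen sets is homeomorphic to the Cantor space. -/
theorem nonempty_homeomorph_natBool [TopologicalSpace X] [CompactSpace X] [Nonempty X]
    (hperf : ∀ x : X, ¬ IsOpen {x}) (U : ℕ → Set X) (hU : ∀ n, IsClopen (U n))
    (hsep : ∀ x y, x ≠ y → ∃ n, x ∈ U n ∧ y ∉ U n) : Nonempty (X ≃ₜ (ℕ → Bool)) := by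
  -- A node is cut by `U n` whenever that is a proper cut, so that every `U n` gets its turn.
  -- Otherwise any separating `U k` serves, a clopen node not being a singleton.
  have hex : ∀ (A : Set X) (n : ℕ), ∃ B ⊆ A, IsClopen A → A.Nonempty →
      IsClopen B ∧ B.Nonempty ∧ (A \ B).Nonempty ∧
      ((∃ x ∈ A, x ∈ U n) → (∃ x ∈ A, x ∉ U n) → B = A ∩ U n) := by
    intro A n
    by_cases h : (∃ x ∈ A, x ∈ U n) ∧ ∃ x ∈ A, x ∉ U n
    · obtain ⟨⟨x, hx, hx'⟩, y, hy, hy'⟩ := h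
      exact ⟨A ∩ U n, inter_subset_left, fun hA _ => ⟨hA.inter (hU n), ⟨x, hx, hx'⟩,
        ⟨y, hy, fun h => hy' h.2⟩, fun _ _ => rfl⟩⟩
    · by_cases hA : IsClopen A ∧ A.Nonempty
      · obtain ⟨hA, x, hx⟩ := hA
        obtain ⟨y, hy, hxy⟩ : ∃ y ∈ A, x ≠ y := by
          by_contra! hc
          have : A = {x} := Subset.antisymm (fun y hy => (hc y hy).symm) (singleton_subset_iff.mpr hx)
          exact hperf x (this ▸ hA.isOpen)
        obtain ⟨k, hk, hk'⟩ := hsep x y hxy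
        exact ⟨A ∩ U k, inter_subset_left, fun _ _ => ⟨hA.inter (hU k), ⟨x, hx, hk⟩,
          ⟨y, hy, fun h => hk' h.2⟩, fun h1 h2 => absurd ⟨h1, h2⟩ h⟩⟩
      · exact ⟨∅, empty_subset _, fun h1 h2 => absurd ⟨h1, h2⟩ hA⟩
  choose sp hsub hsp using hex
  have hclopen : ∀ s n, IsClopen (branch sp s n) ∧ (branch sp s n).Nonempty := by
    intro s n
    induction n with
    | zero => exact ⟨isClopen_univ, univ_nonempty⟩
    | succ n ih =>
      obtain ⟨h1, h2, h3, -⟩ := hsp _ n ih.1 ih.2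
      rw [branch]
      split_ifs
      · exact ⟨h1, h2⟩
      · exact ⟨ih.1.diff h1, h3⟩
  have hcont : Continuous (code sp) := by
    refine continuous_pi fun n => IsLocallyConstant.continuous ?_
    refine (IsLocallyConstant.iff_exists_open _).mpr fun x =>
      ⟨branch sp (code sp x) (n + 1), (hclopen _ _).1.isOpen, ?_, fun y hy => ?_⟩
    · exact (mem_branch_iff hsub).mpr fun _ _ => rfl
    · exact (mem_branch_iff hsub).mp hy n (by omega)
  have hinj : Function.Injective (code sp) := by
    intro x y hxy
    by_contra hne
    obtain ⟨n, hx, hy⟩ := hsep x y hne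
    have hx' : x ∈ branch sp (code sp x) n := (mem_branch_iff hsub).mpr fun _ _ => rfl
    have hy' : y ∈ branch sp (code sp x) n := (mem_branch_iff hsub).mpr fun _ _ => hxy ▸ rfl
    have h := (hsp _ n (hclopen (code sp x) n).1 ⟨x, hx'⟩).2.2.2 ⟨x, hx', hx⟩ ⟨y, hy', hy⟩
    have e : node sp x n = node sp y n := by rw [← branch_code, ← branch_code, hxy]
    have h1 : code sp x n = true := by
      rw [code, ← branch_code, h]; simp [hx, hx']
    have h2 : code sp y n = false := by
      rw [code, ← e, ← branch_code, h]; simp [hy]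
    rw [hxy, h2] at h1
    cases h1
  have hsurj : Function.Surjective (code sp) := by
    intro s
    obtain ⟨x, hx⟩ := IsCompact.nonempty_iInter_of_sequence_nonempty_isCompact_isClosed
      (branch sp s) (fun n x hx => (mem_branch_iff hsub).mpr fun k hk =>
        (mem_branch_iff hsub).mp hx k (by omega))
      (fun n => (hclopen s n).2) (hclopen s 0).1.isClosed.isCompact
      (fun n => (hclopen s n).1.isClosed)
    exact ⟨x, funext fun n => (mem_branch_iff hsub).mp (mem_iInter.mp hx (n + 1)) n (by omega)⟩
  exact ⟨Continuous.homeoOfEquivCompactToT2 (f := Equiv.ofBijective _ ⟨hinj, hsurj⟩) hcont⟩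

end CantorScheme

namespace FigureEight

variable {a : ℕ → ℕ}

/-! ### The inverse limit as a space -/

instance instDiscreteTopologyVertex (n : ℕ) : DiscreteTopology (Vertex a n) := ⟨rfl⟩

instance instFiniteVertex (n : ℕ) : Finite (Vertex a n) := by
  refine Finite.of_surjective
    (fun p : (Σ i : Fin (n + 1), Fin (len a n i + 1)) => circ a n p.1 p.2) fun v => ?_
  by_cases h : v = .base
  · exact ⟨⟨0, 0⟩, by simp [h]⟩
  · obtain ⟨i, j, hi, hj, rfl⟩ := exists_eq_circ v h
    exact ⟨⟨⟨i, by omega⟩, ⟨j, by simp only; omega⟩⟩, rfl⟩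

lemma Limit.ext {x y : Limit a} (h : ∀ n, x.1 n = y.1 n) : x = y := Subtype.ext (funext h)

lemma coord_eq_cover (x : Limit a) (n : ℕ) : x.1 n = cover a n (x.1 (n + 1)) := x.2 n

lemma continuous_coord (n : ℕ) : Continuous fun x : Limit a => x.1 n :=
  (continuous_apply n).comp continuous_subtype_val

lemma isClopen_cylinder (n : ℕ) (v : Vertex a n) : IsClopen {x : Limit a | x.1 n = v} :=
  (isClopen_discrete {v}).preimage (continuous_coord n)

instance instCompactSpaceLimit : CompactSpace (Limit a) := by
  have : IsClosed {x : ∀ n, Vertex a n | ∀ n, x n = cover a n (x (n + 1))} := by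
    rw [Set.ofPred_forall]
    refine isClosed_iInter fun n => isClosed_eq (continuous_apply n) ?_
    exact (continuous_of_discreteTopology (f := cover a n)).comp
      (continuous_apply (A := Vertex a) (n + 1))
  exact isCompact_iff_compactSpace.mp this.isCompact

lemma coord_eq_of_le {x y : Limit a} {m n : ℕ} (hmn : m ≤ n) (h : x.1 n = y.1 n) :
    x.1 m = y.1 m := by
  induction n, hmn using Nat.le_induction with
  | base => exact h
  | succ n _ ih => exact ih (by rw [x.2 n, y.2 n, h])

/-- Cylinders are a neighbourhood basis. -/
lemma exists_cylinder_subset {U : Set (Limit a)} (hU : IsOpen U) {x : Limit a} (hx : x ∈ U) :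
    ∃ n, ∀ y : Limit a, y.1 n = x.1 n → y ∈ U := by
  obtain ⟨V, hV, rfl⟩ := isOpen_induced_iff.mp hU
  obtain ⟨I, u, hu, hsub⟩ := isOpen_pi_iff.mp hV _ hx
  refine ⟨I.sup id, fun y hy => hsub fun i hi => ?_⟩
  have : y.1 i = x.1 i := coord_eq_of_le (Finset.le_sup (f := id) hi) hy
  change y.1 i ∈ u i
  rw [this]
  exact (hu i hi).2

/-- Below level `n` the coordinates are forced by projection; above it they are chosen recursively
by surjectivity of the covers. -/
lemma exists_coord_eq (ha : ∀ n, 2 ≤ a n) {n : ℕ} (v : Vertex a n) : ∃ x : Limit a, x.1 n = v := by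
  have hdown : ∀ (n : ℕ) (v : Vertex a n), ∃ z : ∀ m, Vertex a m, z n = v ∧
      ∀ m < n, z m = cover a m (z (m + 1)) := by
    intro n
    induction n with
    | zero => exact fun v => ⟨Function.update (fun _ => .base) 0 v, by simp⟩
    | succ n ih =>
      intro v
      obtain ⟨z, hz, hc⟩ := ih (cover a n v)
      refine ⟨Function.update z (n + 1) v, by simp, fun m hm => ?_⟩
      rw [Function.update_of_ne (by omega)]
      rcases Nat.lt_succ_iff_lt_or_eq.mp hm with hm | rfl
      · rw [Function.update_of_ne (by omega), hc m hm]
      · rw [Function.update_self, hz]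
  obtain ⟨z, rfl, hc⟩ := hdown n v
  have hs : ∀ m (v : Vertex a m), ∃ u, cover a m u = v := fun m v =>
    let ⟨u, _, _, h, _⟩ := exists_two_cover_eq ha v
    ⟨u, h⟩
  choose s hs using hs
  let w : ∀ m, Vertex a m := fun m =>
    Nat.rec (z 0) (fun m v => if m + 1 ≤ n then z (m + 1) else s m v) m
  have hw : ∀ m, w (m + 1) = if m + 1 ≤ n then z (m + 1) else s m (w m) := fun _ => rfl
  have hwz : ∀ m ≤ n, w m = z m := by
    intro m hm
    cases m with
    | zero => rfl
    | succ m => rw [hw, if_pos hm]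
  refine ⟨⟨w, fun m => ?_⟩, hwz n le_rfl⟩
  by_cases h : m + 1 ≤ n
  · rw [hwz m (by omega), hwz (m + 1) h, hc m h]
  · rw [hw, if_neg h, hs]

instance instNonemptyLimit : Nonempty (Limit a) := ⟨⟨fun _ => .base, fun _ => rfl⟩⟩

theorem nonempty_homeomorph_cantorSet (ha : ∀ n, 2 ≤ a n) : Nonempty (Limit a ≃ₜ cantorSet) := by
  have : Nonempty (Σ n, Vertex a n) := ⟨⟨0, .base⟩⟩
  obtain ⟨e, he⟩ := exists_surjective_nat (Σ n, Vertex a n)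
  obtain ⟨h⟩ := CantorScheme.nonempty_homeomorph_natBool (X := Limit a) (fun x hx => by
      obtain ⟨n, hn⟩ := exists_cylinder_subset hx rfl
      obtain ⟨u, u', huu, hu, hu'⟩ := exists_two_cover_eq ha (x.1 n)
      obtain ⟨y, rfl⟩ := exists_coord_eq ha u
      obtain ⟨y', rfl⟩ := exists_coord_eq ha u'
      have h1 : y = x := hn y (by rw [y.2 n, hu])
      have h2 : y' = x := hn y' (by rw [y'.2 n, hu'])
      exact huu (by rw [h1, h2]))
    (fun k => {x | x.1 (e k).1 = (e k).2}) (fun k => isClopen_cylinder _ _) (fun x y hxy => by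
      obtain ⟨n, hn⟩ : ∃ n, x.1 n ≠ y.1 n := by
        by_contra! hc
        exact hxy (Limit.ext hc)
      obtain ⟨k, hk⟩ := he ⟨n, x.1 n⟩
      exact ⟨k, by change x.1 (e k).1 = (e k).2; rw [hk], by
        change ¬ y.1 (e k).1 = (e k).2; rw [hk]; exact hn.symm⟩)
  exact ⟨h.trans cantorSetHomeomorphNatToBool.symm⟩

/-! ### The inverse limit as a dynamical system -/

/-- The successor of a point of the inverse limit. -/
def shift (x : Limit a) : Limit a :=
  ⟨fun n => cover a n (next (x.1 (n + 1))), fun n => by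
    have h := adj_cover (adj_next (x.1 (n + 2)))
    rw [← x.2 (n + 1)] at h
    exact (cover_eq_of_adj h).symm⟩

/-- The predecessor of a point of the inverse limit. -/
def unshift (x : Limit a) : Limit a :=
  ⟨fun n => cover a n (prev (x.1 (n + 1))), fun n => by
    have h := adj_cover (adj_prev (x.1 (n + 2)))
    rw [← x.2 (n + 1)] at h
    exact (cover_eq_of_adj' h).symm⟩

lemma limitEdge_shift (x : Limit a) : limitEdge a x (shift x) := fun n => by
  rw [x.2 n]
  exact adj_cover (adj_next _)

lemma limitEdge_unshift (x : Limit a) : limitEdge a (unshift x) x := fun n => by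
  rw [x.2 n]
  exact adj_cover (adj_prev _)

lemma eq_shift_of_limitEdge {x y : Limit a} (h : limitEdge a x y) : y = shift x :=
  Limit.ext fun n => by rw [y.2 n, cover_eq_of_adj (h (n + 1))]; rfl

lemma eq_unshift_of_limitEdge {x y : Limit a} (h : limitEdge a x y) : x = unshift y :=
  Limit.ext fun n => by rw [x.2 n, cover_eq_of_adj' (h (n + 1))]; rfl

/-- The homeomorphism of the inverse limit whose graph is the edge relation. -/
def shiftHomeo (a : ℕ → ℕ) : Limit a ≃ₜ Limit a where
  toFun := shift
  invFun := unshift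
  left_inv x := (eq_unshift_of_limitEdge (limitEdge_shift x)).symm
  right_inv x := (eq_shift_of_limitEdge (limitEdge_unshift x)).symm
  continuous_toFun := Continuous.subtype_mk (continuous_pi fun n =>
    (continuous_of_discreteTopology (f := fun v => cover a n (next v))).comp
      (continuous_coord (n + 1))) _
  continuous_invFun := Continuous.subtype_mk (continuous_pi fun n =>
    (continuous_of_discreteTopology (f := fun v => cover a n (prev v))).comp
      (continuous_coord (n + 1))) _

lemma limitEdge_iff (x y : Limit a) : limitEdge a x y ↔ shiftHomeo a x = y :=
  ⟨fun h => (eq_shift_of_limitEdge h).symm, fun h => h ▸ limitEdge_shift x⟩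

lemma adj_iterate (x : Limit a) (n t : ℕ) :
    (graph a n).Adj ((shift^[t] x).1 n) ((shift^[t + 1] x).1 n) := by
  rw [Function.iterate_succ_apply']
  exact limitEdge_shift _ n

lemma coord_iterate_add {x : Limit a} {n i j t : ℕ} (hi : 1 ≤ i ∧ i ≤ n) (hj : 0 < j)
    (h : (shift^[t] x).1 n = circ a n i j) (d : ℕ) (hd : j + d ≤ len a n i) :
    (shift^[t + d] x).1 n = circ a n i (j + d) := by
  induction d with
  | zero => exact h
  | succ d ih =>
    have := adj_iterate x n (t + d)
    rw [ih (by omega), adj_circ_iff (circ_ne_base hi ⟨by omega, by omega⟩)] at this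
    exact this

lemma coord_of_iterate_add {x : Limit a} {n i j t d : ℕ} (hi : 1 ≤ i ∧ i ≤ n)
    (h : (shift^[t + d] x).1 n = circ a n i (j + d)) (hd : j + d < len a n i) :
    (shift^[t] x).1 n = circ a n i j := by
  induction d with
  | zero => exact h
  | succ d ih =>
    refine ih (eq_of_adj_circ_succ (circ_ne_base hi ⟨by omega, hd⟩) ?_) (by omega)
    have := adj_iterate x n (t + d)
    rwa [add_assoc, h] at this

/-- A point starts in the first copy of `c_{n+1,1}` in `c_{n+2,1}`, over the vertex of `U`, and ends
in the second copy, over that of `V`. Using two copies makes the order of `p` and `q` irrelevant. -/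
theorem topologicallyTransitive_shift (ha : ∀ n, 2 ≤ a n) :
    TopDyn.TopologicallyTransitive (shift (a := a)) := by
  rintro U V hU hV ⟨u, hu⟩ ⟨v, hv⟩
  obtain ⟨n₁, hu⟩ := exists_cylinder_subset hU hu
  obtain ⟨n₂, hv⟩ := exists_cylinder_subset hV hv
  set n := max n₁ n₂
  obtain ⟨p, hp0, hp, hpu⟩ := exists_cover_circ_one ha (u.1 n)
  obtain ⟨q, hq0, hq, hqv⟩ := exists_cover_circ_one ha (v.1 n)
  have hcov : ∀ ε d, ε ≤ 1 → d ≤ len a (n + 1) 1 →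
      cover a (n + 1) (circ a (n + 2) 1 (1 + ε * len a (n + 1) 1 + d)) = circ a (n + 1) 1 d := by
    intro ε d hε hd
    simpa using cover_circ_off (a := a) (k := 1) le_rfl le_rfl (by omega : 1 ≤ n + 1) hε hd
  have hlen : 1 + 2 * len a (n + 1) 1 + 1 ≤ len a (n + 2) 1 := by
    simpa using off_add_le (a := a) (le_refl 1) (by omega : 1 ≤ n + 1)
  obtain ⟨x, hx⟩ := exists_coord_eq ha (circ a (n + 2) 1 (1 + 0 * len a (n + 1) 1 + p))
  have hy := coord_iterate_add (x := x) (t := 0) ⟨le_rfl, by omega⟩ (by omega) hx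
    (len a (n + 1) 1 + q - p) (by omega)
  rw [show 1 + 0 * len a (n + 1) 1 + p + (len a (n + 1) 1 + q - p)
    = 1 + 1 * len a (n + 1) 1 + q by omega, zero_add] at hy
  refine ⟨len a (n + 1) 1 + q - p, _, ⟨x, hu x ?_, rfl⟩, hv _ ?_⟩
  · refine coord_eq_of_le (le_max_left n₁ n₂) ?_
    rw [x.2 n, x.2 (n + 1), hx, hcov _ _ (by omega) hp.le, hpu]
  · refine coord_eq_of_le (le_max_right n₁ n₂) ?_
    rw [coord_eq_cover _ n, coord_eq_cover _ (n + 1), hy, hcov _ _ le_rfl hq.le, hqv]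

/-! ### Stretches at the special vertex -/

lemma coord_eq_base_of_le {x : Limit a} {m n : ℕ} (hmn : m ≤ n) (h : x.1 n = .base) :
    x.1 m = .base := by
  induction n, hmn using Nat.le_induction with
  | base => exact h
  | succ n _ ih => exact ih (by rw [x.2 n, h, cover_base])

/-- Each step costs at most one level: a successor of the special vertex projects to the special
vertex one level below. -/
lemma iterate_coord_eq_base {x : Limit a} {m r : ℕ} (h : x.1 (m + r) = .base) {s : ℕ}
    (hs : s ≤ r) : (shift^[s] x).1 m = .base := by
  induction s generalizing x r with
  | zero => exact coord_eq_base_of_le (Nat.le_add_right m r) h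
  | succ s ih =>
    obtain ⟨r, rfl⟩ : ∃ k, r = k + 1 := ⟨r - 1, by omega⟩
    rw [Function.iterate_succ_apply]
    refine ih (r := r) ?_ (by omega)
    change cover a (m + r) (next (x.1 (m + r + 1))) = .base
    have h' : x.1 (m + r + 1) = .base := h
    rw [h', next, cover_base]

lemma iterate_add_coord_eq_base {x : Limit a} {m r t : ℕ} (h : (shift^[t] x).1 (m + r) = .base)
    {s : ℕ} (hs : s ≤ r) : (shift^[t + s] x).1 m = .base := by
  rw [add_comm, Function.iterate_add_apply]
  exact iterate_coord_eq_base h hs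

/-- The index of the circuit on which a vertex lies. -/
def idx {n : ℕ} : Vertex a n → ℕ
  | .base => 0
  | .inner i _ _ _ => i

/-- The position of a vertex on its circuit. -/
def pos {n : ℕ} : Vertex a n → ℕ
  | .base => 0
  | .inner _ j _ _ => j

lemma circ_idx_pos {n : ℕ} (v : Vertex a n) : circ a n (idx v) (pos v) = v := by
  cases v with
  | base => simp [pos]
  | inner i j hi hj => exact circ_of_lt hi hj

lemma idx_pos_bounds {n : ℕ} {v : Vertex a n} (h : v ≠ .base) :
    (1 ≤ idx v ∧ idx v ≤ n) ∧ (0 < pos v ∧ pos v < len a n (idx v)) := by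
  rw [← circ_idx_pos v] at h
  exact of_circ_ne_base h

lemma coord_ne_base_of_le {x : Limit a} {m n : ℕ} (hmn : m ≤ n) (h : x.1 m ≠ .base) :
    x.1 n ≠ .base := fun h' => h (coord_eq_base_of_le hmn h')

lemma position_coord_succ {x : Limit a} {n : ℕ} (h : x.1 n ≠ .base) :
    idx (x.1 (n + 1)) ≤ idx (x.1 n) ∧ ∃ ε ≤ 1, pos (x.1 (n + 1)) =
      off a n (idx (x.1 (n + 1))) (idx (x.1 n)) + ε * len a n (idx (x.1 n)) + pos (x.1 n) := by
  have h1 := idx_pos_bounds (coord_ne_base_of_le (n.le_add_right 1) h)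
  apply position_of_cover_eq h1.1.1
  · rw [circ_idx_pos, circ_idx_pos, x.2 n]
  · rwa [circ_idx_pos]

lemma idx_coord_le {x : Limit a} {m n : ℕ} (hmn : m ≤ n) (h : x.1 m ≠ .base) :
    idx (x.1 n) ≤ idx (x.1 m) := by
  induction n, hmn using Nat.le_induction with
  | base => rfl
  | succ n hn ih => exact (position_coord_succ (coord_ne_base_of_le hn h)).1.trans ih

/-- Circuits of index larger than `n` stay at the special vertex of `G_n`. -/
lemma coord_eq_base_of_lt_idx {x : Limit a} {m n : ℕ} (hmn : n ≤ m) (h : n < idx (x.1 m)) :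
    x.1 n = .base := by
  by_contra h0
  have := idx_coord_le hmn h0
  have := (idx_pos_bounds h0).1.2
  omega

lemma add_two_le_len (ha : ∀ n, 2 ≤ a n) {n j : ℕ} (h1 : 1 ≤ j) (hj : j ≤ n) (r : ℕ) :
    r + 2 ≤ len a (n + r) j := by
  induction r with
  | zero => simpa using two_le_len ha h1 hj
  | succ r ih =>
    have := off_add_le (a := a) (le_refl j) (by omega : j ≤ n + r)
    rw [off_self] at this
    rw [← add_assoc n]
    omega

/-- The first vertex of `c_{n+r,j}` that lies over a vertex of `G_n` other than the special one. -/
lemma coord_eq_circ_one (ha : ∀ n, 2 ≤ a n) {x : Limit a} {n j : ℕ} (h1 : 1 ≤ j) (hj : j ≤ n)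
    (r : ℕ) (h : x.1 (n + r) = circ a (n + r) j (r + 1)) : x.1 n = circ a n j 1 := by
  induction r with
  | zero => exact h
  | succ r ih =>
    refine ih ?_
    have := add_two_le_len ha h1 hj r
    have hc := cover_circ_off (a := a) (n := n + r) (ε := 0) (d := r + 1) h1 le_rfl
      (by omega) (by omega) (by omega)
    rw [off_self, zero_mul, show 1 + 0 + (r + 1) = r + 1 + 1 by omega] at hc
    have h' : x.1 (n + r + 1) = circ a (n + r + 1) j (r + 1 + 1) := h
    rw [x.2 (n + r), h', hc]

/-! ### Proximality -/

lemma exists_iterate_coord_eq_base (x : Limit a) (n : ℕ) :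
    ∃ t ≤ ∑ i ∈ Finset.range (n + 1), len a n i, (shift^[t] x).1 n = .base := by
  by_cases h : x.1 n = .base
  · exact ⟨0, Nat.zero_le _, h⟩
  · have hb := idx_pos_bounds h
    have := coord_iterate_add (x := x) (t := 0) hb.1 hb.2.1 (circ_idx_pos _).symm
      (len a n (idx (x.1 n)) - pos (x.1 n)) (by omega)
    rw [Nat.add_sub_cancel' hb.2.2.le, circ_len, zero_add] at this
    refine ⟨_, (Nat.sub_le _ _).trans ?_, this⟩
    exact Finset.single_le_sum (f := fun i => len a n i) (fun _ _ => Nat.zero_le _)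
      (Finset.mem_range.mpr (by omega))

/-- Any two points visit a given neighbourhood of the fixed point simultaneously, infinitely
often. -/
theorem exists_iterate_coords_eq_base (x y : Limit a) (n K : ℕ) :
    ∃ k ≥ K, (shift^[k] x).1 n = .base ∧ (shift^[k] y).1 n = .base := by
  -- The extra levels equal the bound on the waiting time of `y` at level `n`, so `x` is still at
  -- the special vertex when `y` arrives.
  obtain ⟨t, -, ht⟩ := exists_iterate_coord_eq_base (shift^[K] x)
    (n + ∑ i ∈ Finset.range (n + 1), len a n i)
  obtain ⟨s, hs, hs'⟩ := exists_iterate_coord_eq_base (shift^[t + K] y) n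
  rw [← Function.iterate_add_apply] at ht hs'
  refine ⟨s + (t + K), by omega, ?_, hs'⟩
  rw [add_comm]
  exact iterate_add_coord_eq_base ht hs

/-! ### Ends of circuits -/

/-- `x` is about to complete a circuit `c_{m,j}` with `j ≤ n`. -/
def IsLast (n m : ℕ) (x : Limit a) : Prop :=
  ∃ j p, 1 ≤ j ∧ j ≤ n ∧ p + 1 = len a m j ∧ x.1 m = circ a m j p

/-- The length of the part `2 c_{m,n+1} + ⋯ + 2 c_{m,m}` of the walk over `c_{m+1,j}`, `j ≤ n`. -/
def tailLen (a : ℕ → ℕ) (n m : ℕ) : ℕ := ∑ k ∈ Finset.Ico (n + 1) (m + 1), 2 * len a m k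

lemma off_add_tailLen {j n m : ℕ} (hj : j ≤ n) (hn : n ≤ m) :
    off a m j (n + 1) + tailLen a n m = off a m j (m + 1) := by
  rw [off, off, tailLen, add_assoc, Finset.sum_Ico_consecutive _ (by omega) (by omega)]

/-- A bound for the time between the last visit of a vertex of `G_n` other than the special one and
the completion of a circuit `c_{m,j}` with `j ≤ n`. -/
def trail (a : ℕ → ℕ) (n : ℕ) : ℕ → ℕ
  | 0 => 0
  | m + 1 => trail a n m + tailLen a n m + 1

/-- Over the part `2 c_{m,n+1} + ⋯ + 2 c_{m,m} + e`, the walk stays at the special vertex of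
`G_n`. -/
lemma coord_eq_base_of_off_le {x : Limit a} {n m j p : ℕ} (hn : n ≤ m)
    (h : x.1 (m + 1) = circ a (m + 1) j p) (hp : off a m j (n + 1) ≤ p) : x.1 n = .base := by
  by_contra h0
  have hm := coord_ne_base_of_le hn h0
  have hm1 := coord_ne_base_of_le (m.le_add_right 1) hm
  obtain ⟨hle, ε, hε, he⟩ := position_coord_succ hm
  have hjp := circ_inj ((circ_idx_pos _).trans h) (by rwa [circ_idx_pos])
  have hb := idx_pos_bounds hm
  rcases Nat.lt_or_ge n (idx (x.1 m)) with hlt | hlt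
  · exact h0 (coord_eq_base_of_lt_idx hn hlt)
  · rw [hjp.1] at he hle
    have h2 := off_mono (a := a) m j (Nat.succ_le_succ hlt)
    rw [Nat.succ_eq_add_one, off_succ hle] at h2
    have h3 : ε * len a m (idx (x.1 m)) ≤ 1 * len a m (idx (x.1 m)) := Nat.mul_le_mul_right _ hε
    rw [Nat.succ_eq_add_one] at h2
    omega

/-- If two points agree at the level `n` from the time `K` on, then they complete the circuits
`c_{m,j}`, `j ≤ n`, simultaneously. -/
theorem IsLast.of_eventually_eq (ha : ∀ n, 2 ≤ a n) {x y : Limit a} {n K : ℕ}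
    (h : ∀ t ≥ K, (shift^[t] x).1 n = (shift^[t] y).1 n) (r t : ℕ)
    (ht : K + trail a n (n + r) ≤ t) (hx : IsLast n (n + r) (shift^[t] x)) :
    IsLast n (n + r) (shift^[t] y) := by
  induction r generalizing t with
  | zero =>
    obtain ⟨j, p, h1, h2, h3, h4⟩ := hx
    exact ⟨j, p, h1, h2, h3, (h t (by omega)).symm.trans h4⟩
  | succ r ih =>
    obtain ⟨j, p, h1, h2, h3, h4⟩ := hx
    set m := n + r with hm
    rw [← add_assoc, ← hm] at h3 h4 ht ⊢
    rw [trail] at ht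
    have hoff := off_add_tailLen (a := a) h2 (by omega : n ≤ m)
    rw [len_succ (by omega)] at h3
    have hsucc := off_succ (a := a) (n := m) h2
    have hn1 : 1 ≤ n := by omega
    have hln : 2 ≤ len a m n := two_le_len ha hn1 (by omega)
    set S := tailLen a n m
    -- At time `s`, before the tail of length `S`, `x` is at the last vertex of the second copy of
    -- `c_{m,n}`; the induction hypothesis applies there.
    obtain ⟨s, rfl⟩ : ∃ s, t = s + (S + 1) := ⟨t - (S + 1), by omega⟩
    have hp : p = off a m j n + 1 * len a m n + (len a m n - 1) + (S + 1) := by omega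
    have hlen := len_succ (a := a) (by omega : j ≤ m)
    -- the position of `x` at the time `s`
    have hxs : (shift^[s] x).1 (m + 1)
        = circ a (m + 1) j (off a m j n + 1 * len a m n + (len a m n - 1)) :=
      coord_of_iterate_add ⟨h1, by omega⟩ (hp ▸ h4) (by omega)
    have hxm : (shift^[s] x).1 m = circ a m n (len a m n - 1) := by
      rw [coord_eq_cover _ m, hxs, cover_circ_off h1 h2 (by omega) le_rfl (by omega)]
    obtain ⟨j', p', h1', h2', h3', h4'⟩ := ih s (by omega)
      ⟨n, len a m n - 1, hn1, le_rfl, by omega, hxm⟩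
    -- the position of `y` at the time `s`
    have hl' : 2 ≤ len a m j' := two_le_len ha h1' (by omega)
    have hym : (shift^[s] y).1 m ≠ .base := by
      rw [h4']; exact circ_ne_base ⟨h1', by omega⟩ ⟨by omega, by omega⟩
    have hyb := idx_pos_bounds (coord_ne_base_of_le (m.le_add_right 1) hym)
    have hidx := circ_inj ((circ_idx_pos _).trans h4') (by rwa [circ_idx_pos])
    obtain ⟨hq, ε, hε, hpos⟩ := position_coord_succ hym
    rw [hidx.1] at hq hpos
    rw [hidx.2] at hpos
    have hys := (circ_idx_pos ((shift^[s] y).1 (m + 1))).symm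
    set q := idx ((shift^[s] y).1 (m + 1))
    set pp := pos ((shift^[s] y).1 (m + 1))
    have hoffq := off_add_tailLen (a := a) (hq.trans h2') (by omega : n ≤ m)
    have hsuccq := off_succ (a := a) (n := m) hq
    have hlenq := len_succ (a := a) (by omega : q ≤ m)
    have hqle := off_add_le (a := a) hq (by omega : j' ≤ m)
    have hstep := coord_iterate_add hyb.1 hyb.2.1 hys
    -- Either `y` also ends the second copy of `c_{m,n}`, or a further copy of some `c_{m,j''}` with
    -- `j'' ≤ n` follows at once. The latter shows a non-special vertex of `G_n` after `r + 2`
    -- steps.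
    have hcase : (ε = 1 ∧ j' = n) ∨ ∃ j'' ε', q ≤ j'' ∧ j'' ≤ n ∧ ε' ≤ 1 ∧
        pp + 1 = off a m q j'' + ε' * len a m j'' := by
      interval_cases ε
      · exact Or.inr ⟨j', 1, hq, h2', le_rfl, by omega⟩
      · rcases h2'.eq_or_lt with e | hlt
        · exact Or.inl ⟨rfl, e⟩
        · exact Or.inr ⟨j' + 1, 0, by omega, hlt, by omega, by omega⟩
    rcases hcase with ⟨rfl, rfl⟩ | ⟨j'', ε', hj1, hj2, hε', hpp⟩
    · exact ⟨q, pp + (S + 1), hyb.1.1, hq.trans h2', by omega, hstep (S + 1) (by omega)⟩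
    · exfalso
      have hl'' : r + 2 ≤ len a m j'' := add_two_le_len ha (hyb.1.1.trans hj1) hj2 r
      have hle'' := off_add_le (a := a) hj1 (by omega : j'' ≤ m)
      have hε'' : ε' * len a m j'' ≤ 1 * len a m j'' := Nat.mul_le_mul_right _ hε'
      have hy1 := hstep (r + 2) (by omega)
      have hy2 : (shift^[s + (r + 2)] y).1 m = circ a m j'' (r + 1) := by
        rw [coord_eq_cover _ m, hy1, show pp + (r + 2)
          = off a m q j'' + ε' * len a m j'' + (r + 1) by omega,
          cover_circ_off hyb.1.1 hj1 (by omega) hε' (by omega)]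
      have hy3 := coord_eq_circ_one ha (hyb.1.1.trans hj1) hj2 r hy2
      rw [← h _ (by omega)] at hy3
      have hne := circ_ne_base (a := a) (n := n) (i := j'') (j := 1) ⟨by omega, hj2⟩
        ⟨one_pos, two_le_len ha (by omega) hj2⟩
      rw [← hy3] at hne
      apply hne
      -- At that moment `x` is at the special vertex of `G_n`: with a short tail it has recently
      -- been at the special vertex of level `m + 1`, otherwise it is still over the tail or the
      -- final `e`.
      rcases Nat.lt_or_ge S (r + 1) with hS | hS
      · have hbase := adj_iterate x (m + 1) (s + (S + 1))
        rw [h4, adj_circ_iff (circ_ne_base ⟨h1, by omega⟩ ⟨by omega, by omega⟩),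
          circ_of_len_le (by omega)] at hbase
        have := iterate_add_coord_eq_base (m := n) (r := r + 1) hbase (s := r - S) (by omega)
        rwa [show s + (S + 1) + 1 + (r - S) = s + (r + 2) by omega] at this
      · refine coord_eq_base_of_off_le (m := m) (by omega)
          (coord_iterate_add ⟨h1, by omega⟩ (by omega) hxs (r + 2) (by omega)) (by omega)

/-! ### Asymptotic points are equal -/

/-- The time that `x` needs to complete its present circuit of `G_m`. -/
def remaining (x : Limit a) (m : ℕ) : ℕ := len a m (idx (x.1 m)) - pos (x.1 m)

/-- From the level `M` on, `x` lies on the circuit of index `i`. -/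
def HasLimitIndex (x : Limit a) (i M : ℕ) : Prop :=
  ∀ m ≥ M, x.1 m ≠ .base ∧ idx (x.1 m) = i

/-- The index is nonincreasing in the level, hence eventually equal to its minimum. -/
lemma exists_hasLimitIndex {x : Limit a} {n : ℕ} (h : x.1 n ≠ .base) :
    ∃ i M, HasLimitIndex x i M := by
  classical
  have hex : ∃ i, ∃ m ≥ n, idx (x.1 m) = i := ⟨_, n, le_rfl, rfl⟩
  obtain ⟨M, hM, hi⟩ := Nat.find_spec hex
  refine ⟨Nat.find hex, M, fun m hm => ⟨coord_ne_base_of_le (by omega) h, le_antisymm ?_ ?_⟩⟩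
  · exact (idx_coord_le hm (coord_ne_base_of_le hM h)).trans hi.le
  · exact Nat.find_min' hex ⟨m, by omega, rfl⟩

/-- Here `ε` counts the copies of `c_{m,i}` still ahead; the final summand is the closing `e`. -/
lemma HasLimitIndex.remaining_succ {x : Limit a} {i M m : ℕ} (h : HasLimitIndex x i M)
    (hm : M ≤ m) : ∃ ε ≤ 1,
      remaining x (m + 1) = remaining x m + ε * len a m i + tailLen a i m + 1 := by
  obtain ⟨h0, h1⟩ := h m hm
  obtain ⟨-, h2⟩ := h (m + 1) (by omega)
  obtain ⟨-, ε, hε, he⟩ := position_coord_succ h0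
  have hb := idx_pos_bounds h0
  rw [h1] at hb
  rw [h1, h2, off_self] at he
  have hoff := off_add_tailLen (a := a) le_rfl hb.1.2
  rw [off_succ le_rfl, off_self] at hoff
  refine ⟨1 - ε, Nat.sub_le _ _, ?_⟩
  rw [remaining, remaining, h1, h2, he, len_succ hb.1.2, ← hoff]
  interval_cases ε <;> omega

/-- As `i < n`, the tail after index `i` also contains `2 c_{m,n}`, so `remaining` gains on `trail`
at every level. -/
lemma HasLimitIndex.remaining_trail (ha : ∀ n, 2 ≤ a n) {x : Limit a} {i M n : ℕ}
    (h : HasLimitIndex x i M) (hi : i < n) {m : ℕ} (hm : M ≤ m) (hn : n ≤ M) :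
    trail a n m + (m - M) ≤ remaining x m + trail a n M := by
  induction m, hm using Nat.le_induction with
  | base => omega
  | succ m hm ih =>
    obtain ⟨ε, hε, he⟩ := h.remaining_succ hm
    rw [he, trail]
    have hn' : 2 ≤ len a m n := two_le_len ha (by omega) (by omega)
    have h1 : off a m (i + 1) (n + 1) + tailLen a n m = off a m (i + 1) (m + 1) :=
      off_add_tailLen (by omega) (by omega)
    have h2 := off_succ (a := a) (n := m) (by omega : i + 1 ≤ n)
    have h3 : 1 + tailLen a i m = off a m (i + 1) (m + 1) := rfl
    have h4 := one_le_off (a := a) m (i + 1) n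
    omega

lemma HasLimitIndex.isLast {x : Limit a} {i M n : ℕ} (h : HasLimitIndex x i M) (hi : i ≤ n)
    {m : ℕ} (hm : M ≤ m) : IsLast n m (shift^[remaining x m - 1] x) := by
  obtain ⟨h0, h1⟩ := h m hm
  have hb := idx_pos_bounds h0
  have := coord_iterate_add (x := x) (t := 0) hb.1 hb.2.1 (circ_idx_pos _).symm
    (remaining x m - 1) (by unfold remaining; omega)
  rw [zero_add] at this
  exact ⟨_, _, hb.1.1, h1.le.trans hi, by unfold remaining; omega, this⟩

/-- Before its remaining time is nearly over, `y` is still inside its present circuit, short of the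
last vertex. -/
lemma remaining_le_of_isLast (ha : ∀ n, 2 ≤ a n) {y : Limit a} {n m t : ℕ} (hn : n ≤ m)
    (h : y.1 m ≠ .base) (hy : IsLast n m (shift^[t] y)) : remaining y m ≤ t + 1 := by
  by_contra! hlt
  obtain ⟨j, p, h1, h2, h3, h4⟩ := hy
  have hb := idx_pos_bounds h
  unfold remaining at hlt
  have := coord_iterate_add (x := y) (t := 0) hb.1 hb.2.1 (circ_idx_pos _).symm t (by omega)
  rw [zero_add, h4] at this
  have hl := two_le_len ha h1 (by omega : j ≤ m)
  obtain ⟨rfl, rfl⟩ := circ_inj this (circ_ne_base ⟨h1, by omega⟩ ⟨by omega, by omega⟩)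
  omega

lemma exists_isLast_remaining (ha : ∀ n, 2 ≤ a n) {x y : Limit a} {i M n K : ℕ}
    (hx : HasLimitIndex x i M) (hi : i < n)
    (h : ∀ t ≥ K, (shift^[t] x).1 n = (shift^[t] y).1 n) :
    ∃ M', ∀ m ≥ M', 1 ≤ remaining x m ∧ IsLast n m (shift^[remaining x m - 1] y) := by
  set M₁ := max M n
  have hx' : HasLimitIndex x i M₁ := fun m hm => hx m ((le_max_left M n).trans hm)
  refine ⟨M₁ + K + trail a n M₁ + 1, fun m hm => ?_⟩
  have hn : n ≤ M₁ := le_max_right M n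
  have h1 := hx'.remaining_trail ha hi (by omega : M₁ ≤ m) hn
  obtain ⟨r, rfl⟩ : ∃ r, m = n + r := ⟨m - n, by omega⟩
  exact ⟨by omega, IsLast.of_eventually_eq ha h r _ (by omega) (hx'.isLast hi.le (by omega))⟩

/-- If `i < i'`, the increment for `x` includes both copies of `c_{m,i'}`, that for `y` at most one.
-/
lemma HasLimitIndex.not_lt_of_remaining_eq (ha : ∀ n, 2 ≤ a n) {x y : Limit a} {i i' M M' N : ℕ}
    (hx : HasLimitIndex x i M) (hy : HasLimitIndex y i' M')
    (h : ∀ m ≥ N, remaining x m = remaining y m) : ¬ i < i' := by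
  intro hii
  set m := max N (max M M')
  have hN : N ≤ m := le_max_left _ _
  have hM : M ≤ m := (le_max_left _ _).trans (le_max_right _ _)
  have hM' : M' ≤ m := (le_max_right _ _).trans (le_max_right _ _)
  obtain ⟨ε, -, he⟩ := hx.remaining_succ hM
  obtain ⟨ε', hε', he'⟩ := hy.remaining_succ hM'
  rw [h (m + 1) (by omega), he', h m hN] at he
  have hb := (idx_pos_bounds (hy m hM').1).1
  rw [(hy m hM').2] at hb
  have hl : 2 ≤ len a m i' := two_le_len ha hb.1 hb.2
  have h1 : off a m (i + 1) (i' + 1) + tailLen a i' m = off a m (i + 1) (m + 1) :=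
    off_add_tailLen (by omega) (by omega)
  have h2 := off_succ (a := a) (n := m) (by omega : i + 1 ≤ i')
  have h3 : 1 + tailLen a i m = off a m (i + 1) (m + 1) := rfl
  have h4 := one_le_off (a := a) m (i + 1) i'
  have h5 : ε' * len a m i' ≤ 1 * len a m i' := Nat.mul_le_mul_right _ hε'
  omega

lemma exists_eq_base_of_asymptotic (ha : ∀ n, 2 ≤ a n) {x y : Limit a}
    (h : ∀ n, ∃ K, ∀ t ≥ K, (shift^[t] x).1 n = (shift^[t] y).1 n)
    (hy : ∀ m, y.1 m = .base) (n : ℕ) : x.1 n = .base := by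
  by_contra h0
  obtain ⟨i, M, hi⟩ := exists_hasLimitIndex h0
  obtain ⟨K, hK⟩ := h (i + 1)
  obtain ⟨M', hM'⟩ := exists_isLast_remaining ha hi (Nat.lt_succ_self i) hK
  obtain ⟨-, j, p, h1, h2, h3, h4⟩ := hM' (max M' (i + 1)) (le_max_left _ _)
  have hle := le_max_right M' (i + 1)
  have hl := two_le_len ha h1 (h2.trans hle)
  refine circ_ne_base (a := a) ⟨h1, h2.trans hle⟩ ⟨by omega, by omega⟩ (h4.symm.trans ?_)
  exact iterate_coord_eq_base (hy _) le_rfl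

/-- Distinct points are not asymptotic. -/
theorem eq_of_asymptotic (ha : ∀ n, 2 ≤ a n) {x y : Limit a}
    (h : ∀ n, ∃ K, ∀ t ≥ K, (shift^[t] x).1 n = (shift^[t] y).1 n) : x = y := by
  have h' : ∀ n, ∃ K, ∀ t ≥ K, (shift^[t] y).1 n = (shift^[t] x).1 n := fun n =>
    (h n).imp fun K hK t ht => (hK t ht).symm
  by_cases hy : ∀ m, y.1 m = .base
  · exact Limit.ext fun n => (exists_eq_base_of_asymptotic ha h hy n).trans (hy n).symm
  by_cases hx : ∀ m, x.1 m = .base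
  · exact Limit.ext fun n => (hx n).trans (exists_eq_base_of_asymptotic ha h' hx n).symm
  push Not at hx hy
  obtain ⟨i, M, hi⟩ := exists_hasLimitIndex hx.choose_spec
  obtain ⟨i', M', hi'⟩ := exists_hasLimitIndex hy.choose_spec
  set n := max i i' + 1
  have hin : i < n := Nat.lt_succ_of_le (le_max_left _ _)
  have hin' : i' < n := Nat.lt_succ_of_le (le_max_right _ _)
  obtain ⟨K, hK⟩ := h n
  obtain ⟨N, hN⟩ := exists_isLast_remaining ha hi hin hK
  obtain ⟨N', hN'⟩ := exists_isLast_remaining ha hi' hin' fun t ht => (hK t ht).symm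
  have hrem : ∀ m ≥ M + M' + N + N' + n, remaining x m = remaining y m := by
    intro m hm
    obtain ⟨h1, h2⟩ := hN m (by omega)
    obtain ⟨h1', h2'⟩ := hN' m (by omega)
    have h3 := remaining_le_of_isLast ha (by omega) (hi' m (by omega)).1 h2
    have h3' := remaining_le_of_isLast ha (by omega) (hi m (by omega)).1 h2'
    omega
  have hii : i = i' := le_antisymm
    (not_lt.mp (hi'.not_lt_of_remaining_eq ha hi fun m hm => (hrem m hm).symm))
    (not_lt.mp (hi.not_lt_of_remaining_eq ha hi' hrem))
  subst hii
  refine Limit.ext fun k => coord_eq_of_le (Nat.le_add_right k (M + M' + N + N' + n)) ?_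
  set m := k + (M + M' + N + N' + n)
  obtain ⟨hx0, hx1⟩ := hi m (by omega)
  obtain ⟨hy0, hy1⟩ := hi' m (by omega)
  have hbx := idx_pos_bounds hx0
  have hby := idx_pos_bounds hy0
  have := hrem m (by omega)
  unfold remaining at this
  rw [hx1] at this hbx
  rw [hy1] at this hby
  rw [← circ_idx_pos (x.1 m), ← circ_idx_pos (y.1 m), hx1, hy1,
    show pos (x.1 m) = pos (y.1 m) by omega]

/-! ### Failure of local equicontinuity -/

/-- A point that is not an equicontinuity point of the closure of its orbit: its coordinate at each
level `m` is the vertex of `c_{m,1}` at the position `m`. -/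
def diagonal (ha : ∀ n, 2 ≤ a n) : Limit a :=
  ⟨fun m => circ a m 1 m, fun m => by
    cases m with
    | zero =>
      change circ a 0 1 0 = cover a 0 (circ a 1 1 1)
      rw [circ_zero, cover_circ_of_gt one_pos]
    | succ m =>
      have h := add_two_le_len ha le_rfl (le_refl 1) m
      have hc := cover_circ_off (a := a) (n := m + 1) (ε := 0) (d := m + 1) (le_refl 1) le_rfl
        (by omega) (by omega) (by rw [add_comm m 1]; omega)
      rw [off_self, zero_mul, show 1 + 0 + (m + 1) = m + 1 + 1 by omega] at hc
      exact hc.symm⟩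

theorem exists_iterate_diagonal_ne (ha : ∀ n, 2 ≤ a n) (r : ℕ) :
    ∃ s t, (shift^[s] (diagonal ha)).1 (2 + r) = (diagonal ha).1 (2 + r) ∧
      (shift^[t] (diagonal ha)).1 2 ≠ (shift^[t] (shift^[s] (diagonal ha))).1 2 := by
  set x := diagonal ha with hx
  set m := 2 + r with hm
  have hl1 : r + 3 ≤ len a m 1 := by
    have := add_two_le_len ha le_rfl (le_refl 1) (r + 1)
    rwa [show 1 + (r + 1) = m by omega] at this
  have hl2 : r + 2 ≤ len a m 2 := add_two_le_len ha (by omega) (le_refl 2) r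
  have hle1 := off_add_le (a := a) (le_refl 1) (by omega : 1 ≤ m)
  have hle2 := off_add_le (a := a) (by omega : 1 ≤ 2) (by omega : 2 ≤ m)
  have hs : off a m 1 2 = off a m 1 1 + 2 * len a m 1 := off_succ le_rfl
  rw [off_self] at hle1 hs
  have h0 : (shift^[0] x).1 (m + 1) = circ a (m + 1) 1 (m + 1) := rfl
  have hit := coord_iterate_add (x := x) ⟨le_rfl, by omega⟩ (by omega) h0
  simp only [zero_add] at hit
  refine ⟨len a m 1, len a m 1 - 1, ?_, ?_⟩
  · rw [coord_eq_cover _ m, hit _ (by omega), show m + 1 + len a m 1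
      = off a m 1 1 + 1 * len a m 1 + m by rw [off_self]; omega,
      cover_circ_off le_rfl le_rfl (by omega) le_rfl (by omega)]
    rfl
  -- Position `r + 1` on a circuit of `G_{2+r}` of index at most 2 lies over the first inner vertex
  -- of the circuit of the same index in `G_2`.
  · have h1 : (shift^[len a m 1 - 1] x).1 m = circ a m 1 (r + 1) := by
      rw [coord_eq_cover _ m, hit _ (by omega), show m + 1 + (len a m 1 - 1)
        = off a m 1 1 + 1 * len a m 1 + (r + 1) by rw [off_self]; omega,
        cover_circ_off le_rfl le_rfl (by omega) le_rfl (by omega)]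
    have h2 : (shift^[len a m 1 - 1] (shift^[len a m 1] x)).1 m = circ a m 2 (r + 1) := by
      rw [← Function.iterate_add_apply, coord_eq_cover _ m, hit _ (by omega),
        show m + 1 + (len a m 1 - 1 + len a m 1)
        = off a m 1 2 + 0 * len a m 2 + (r + 1) by rw [hs]; omega,
        cover_circ_off le_rfl (by omega) (by omega) (by omega) (by omega)]
    rw [coord_eq_circ_one ha le_rfl (by omega) r h1, coord_eq_circ_one ha (by omega) le_rfl r h2]
    intro h
    have := (circ_inj h (circ_ne_base ⟨le_rfl, by omega⟩
      ⟨one_pos, two_le_len ha le_rfl (by omega)⟩)).1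
    omega

end FigureEight

/-! ### Scrambled pairs and equicontinuity in terms of discrete coordinates -/

namespace TopDyn

open Filter Topology
open scoped ENNReal

/-- The pairs separated by `g` form a compact set off the diagonal. This makes the metric statements
independent of the choice of metric. -/
lemma exists_pos_le_edist {X Y : Type*} [MetricSpace X] [CompactSpace X] [TopologicalSpace Y]
    [DiscreteTopology Y] {g : X → Y} (hg : Continuous g) :
    ∃ δ : ℝ≥0∞, 0 < δ ∧ ∀ u v, g u ≠ g v → δ ≤ edist u v := by
  have hclosed : IsClosed {p : X × X | g p.1 ≠ g p.2} :=
    (isClosed_discrete {q : Y × Y | q.1 ≠ q.2}).preimage (hg.prodMap hg)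
  rcases Set.eq_empty_or_nonempty {p : X × X | g p.1 ≠ g p.2} with he | hne
  · exact ⟨1, one_pos, fun u v huv => absurd (he ▸ huv : (u, v) ∈ (∅ : Set (X × X))) id⟩
  · obtain ⟨p, hp, hmin⟩ := hclosed.isCompact.exists_isMinOn hne
      (f := fun p : X × X => edist p.1 p.2) (continuous_fst.edist continuous_snd).continuousOn
    exact ⟨_, edist_pos.mpr fun h => hp (congrArg g h),
      fun u v huv => hmin (show (u, v) ∈ {p : X × X | g p.1 ≠ g p.2} from huv)⟩

variable {X : Type*} [T : TopologicalSpace X] [CompactSpace X] {V : ℕ → Type*}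
  [∀ n, TopologicalSpace (V n)] [∀ n, DiscreteTopology (V n)] {g : ∀ n, X → V n}

theorem completelyScrambled_of_coords (hg : ∀ n, Continuous (g n)) {f : X → X} {p : X}
    (hp : ∀ U : Set X, IsOpen U → p ∈ U → ∃ n, ∀ x, g n x = g n p → x ∈ U)
    (hprox : ∀ x y n K, ∃ k ≥ K, g n (f^[k] x) = g n p ∧ g n (f^[k] y) = g n p)
    (hasym : ∀ x y, x ≠ y → ∃ n, ∀ K, ∃ k ≥ K, g n (f^[k] x) ≠ g n (f^[k] y))
    (d : MetricSpace X) (hd : d.toUniformSpace.toTopologicalSpace = T) :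
    CompletelyScrambled f := by
  subst hd
  intro x _ y _ hxy
  constructor
  · obtain ⟨n, hn⟩ := hasym x y hxy
    obtain ⟨δ, hδ, h⟩ := exists_pos_le_edist (hg n)
    refine hδ.trans_le (le_limsup_of_frequently_le' (frequently_atTop.mpr fun K => ?_))
    obtain ⟨k, hk, hne⟩ := hn K
    exact ⟨k, hk, h _ _ hne⟩
  · refine le_antisymm (le_of_forall_gt_imp_ge_of_dense fun ε hε => ?_) zero_le
    obtain ⟨n, hn⟩ := hp (Metric.eball p (ε / 2)) Metric.isOpen_eball
      (Metric.mem_eball_self (ENNReal.half_pos hε.ne'))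
    refine liminf_le_of_frequently_le' (frequently_atTop.mpr fun K => ?_)
    obtain ⟨k, hk, h1, h2⟩ := hprox x y n K
    refine ⟨k, hk, (edist_triangle_right _ _ p).trans ?_⟩
    rw [← ENNReal.add_halves ε]
    exact add_le_add (hn _ h1).le (hn _ h2).le

theorem not_locallyEquicontinuous_of_coords {f : Equiv.Perm X} {x : X}
    (hx : ∀ U : Set X, IsOpen U → x ∈ U → ∃ n, ∀ m ≥ n, ∀ y, g m y = g m x → y ∈ U) {N : ℕ}
    (hg : Continuous (g N))
    (h : ∀ n, ∃ m ≥ n, ∃ s t : ℕ, g m (f^[s] x) = g m x ∧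
      g N (f^[t] x) ≠ g N (f^[t] (f^[s] x)))
    (d : MetricSpace X) (hd : d.toUniformSpace.toTopologicalSpace = T) :
    ¬ LocallyEquicontinuous f := by
  subst hd
  intro heq
  obtain ⟨δ, hδ, hle⟩ := exists_pos_le_edist hg
  obtain ⟨U, hU, hxU, hsub⟩ := mem_nhdsWithin.mp (heq x _ (edist_mem_uniformity hδ))
  obtain ⟨n, hn⟩ := hx U hU hxU
  obtain ⟨m, hm, s, t, hs, hne⟩ := h n
  have hmem : f^[s] x ∈ closure (orbit f x) :=
    subset_closure ⟨s, by simp [Equiv.Perm.iterate_eq_pow]⟩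
  have := hsub ⟨hn m hm _ hs, hmem⟩ t
  exact absurd (hle _ _ hne) (not_le.mpr this)

end TopDyn

theorem mainTheorem1 (a : ℕ → ℕ) (ha : ∀ n, 2 ≤ a n) :
    (∀ n, GraphCover.IsBidirectionalCover (FigureEight.graph a (n + 1)) (FigureEight.graph a n)
      (FigureEight.cover a n)) ∧
    ∃ f : FigureEight.Limit a ≃ₜ FigureEight.Limit a,
      (∀ x y : FigureEight.Limit a, FigureEight.limitEdge a x y ↔ f x = y) ∧
      Nonempty (FigureEight.Limit a ≃ₜ cantorSet) ∧
      TopDyn.TopologicallyTransitive (⇑f) ∧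
      ∀ d : MetricSpace (FigureEight.Limit a),
        d.toUniformSpace.toTopologicalSpace = FigureEight.instTopologicalSpaceLimit a →
        TopDyn.CompletelyScrambled (⇑f) ∧ ¬ TopDyn.LocallyEquicontinuous f.toEquiv := by
  refine ⟨FigureEight.isBidirectionalCover_cover a, FigureEight.shiftHomeo a,
    FigureEight.limitEdge_iff, FigureEight.nonempty_homeomorph_cantorSet ha,
    FigureEight.topologicallyTransitive_shift ha, fun d hd => ⟨?_, ?_⟩⟩
  · refine TopDyn.completelyScrambled_of_coords (g := fun n x => x.1 n)
      (p := ⟨fun _ => .base, fun _ => rfl⟩) FigureEight.continuous_coord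
      (fun U hU hp => FigureEight.exists_cylinder_subset hU hp)
      FigureEight.exists_iterate_coords_eq_base (fun x y hxy => ?_) d hd
    by_contra! hc
    exact hxy (FigureEight.eq_of_asymptotic ha hc)
  · refine TopDyn.not_locallyEquicontinuous_of_coords (g := fun n x => x.1 n)
      (x := FigureEight.diagonal ha) (N := 2) (fun U hU hx => ?_) (FigureEight.continuous_coord 2)
      (fun n => ?_) d hd
    · obtain ⟨n, hn⟩ := FigureEight.exists_cylinder_subset hU hx
      exact ⟨n, fun m hm y hy => hn y (FigureEight.coord_eq_of_le hm hy)⟩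
    · exact ⟨2 + n, by omega, FigureEight.exists_iterate_diagonal_ne ha n⟩
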